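/- Let $\Sigma$ be a finite nonempty alphabet and $L\subseteq\Sigma^*$ a regular language. A \emph{streaming algorithm} over an alphabet $\Delta$ for a language $K\subseteq\Delta^*$ is a deterministic, possibly infinite automaton accepting $K$, together with an injective encoding $\mathrm{enc}$ of its states by bit strings; $\mathcal A(u)$ denotes the state reached by $\mathcal A$ on input $u$ from the initial state. Fix $a\in\Sigma$. For $w\in\Sigma^*$ let $\mathrm{last}_n(w)$ be the suffix of length $n$ of $w$ if $|w|\ge n$, and $a^{n-|w|}w$ otherwise. For $s\colon\mathbb N\to\mathbb N$, the class $\mathsf F(s)$ consists of the languages $K\subseteq\Sigma^*$ for which there are streaming algorithms $\mathcal A_n$ ($n\ge 0$) such that, for each $n$, $\mathcal A_n$ is a streaming algorithm for $\{w\in\Sigma^*:\mathrm{last}_n(w)\in K\}$ all of whose states have encodings of length at most $s(n)$. Let $\overline\Sigma=\Sigma\cup\{\downarrow\}$, with $\downarrow$ a new symbol. The window $\mathrm{wnd}(u)\in\Sigma^*$ of a stream $u\in\overline\Sigma^*$ starts empty; reading $b\in\Sigma$ appends $b$ on the right, and reading $\downarrow$ removes the first symbol (if there is one). The class $\mathsf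 V(s)$ consists of the languages $K\subseteq\Sigma^*$ for which there is a streaming algorithm $\mathcal A$ for $\{u\in\overline\Sigma^*:\mathrm{wnd}(u)\in K\}$ such that, for every $n$ and every $u\in\overline\Sigma^*$ with $|\mathrm{wnd}(v)|\le n$ for all prefixes $v$ of $u$, one has $|\mathrm{enc}(\mathcal A(v))|\le s(n)$ for all prefixes $v$ of $u$. Put $\mathsf F(\mathcal O(\log n))=\bigcup_{s\in\mathcal O(\log n)}\mathsf F(s)$ and $\mathsf V(\mathcal O(\log n))=\bigcup_{s\in\mathcal O(\log n)}\mathsf V(s)$. A DFA (with finite state set, initial state $q_0$, transition function $\delta$, extended to words, and set $F$ of final states) is \emph{well-behaved} if for every strongly connected component $C$ reachable from $q_0$, every $q\in C$ and all words $u,v$ with $|u|=|v|$ and $\delta(q,u),\delta(q,v)\in C$, one has $\delta(q,u)\in F$ if and only if $\delta(q,v)\in F$. The language $L$ is \emph{$\leftarrow$-reducible} to $K\subseteq\Gamma^*$ if there is a finite-state Mealy machine with input alphabet $\Sigma$ and output alphabet $\Gamma$, computing (from its initial state) a length-preserving map $\tau\colon\Sigma^*\to\Gamma^*$, such that for all $x\in\Sigma^*$: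 $x\in L$ if and only if $\tau(x^{\mathsf R})^{\mathsf R}\in K$, where $^{\mathsf R}$ denotes reversal. A language $K$ over a finite alphabet has \emph{polynomial growth} if $|\{x\in K:|x|\le n\}|\in\mathcal O(n^d)$ for some $d\in\mathbb N$. A language $K\subseteq\Sigma^*$ is a \emph{left ideal} if $\Sigma^*K\subseteq K$, and a \emph{length language} if for every $n$ either $\Sigma^n\subseteq K$ or $K\cap\Sigma^n=\emptyset$. Theorem. The following are equivalent: 1. $L\in\mathsf F(\mathcal O(\log n))$; 2. $L\in\mathsf V(\mathcal O(\log n))$; 3. the reversal $L^{\mathsf R}=\{x^{\mathsf R}:x\in L\}$ is recognized by a well-behaved DFA; 4. $L$ is $\leftarrow$-reducible to a regular language of polynomial growth over some finite alphabet; 5. $L$ is a Boolean combination of regular left ideals and regular length languages over $\Sigma$. -/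

import Mathlib

namespace SlidingWindow

/-- A streaming algorithm over `α`: a deterministic, possibly infinite automaton (Mathlib's `DFA`
does not require finitely many states) together with an injective encoding of its states by bit
strings. As the states inject into the bit strings, `Type` is large enough for them. -/
structure StreamingAlgorithm (α : Type*) where
  State : Type
  aut : DFA α State
  enc : State → List Bool
  enc_injective : Function.Injective enc

/-- `𝒜` is a streaming algorithm for the language `L`. -/
def StreamingAlgorithm.IsFor {α : Type*} (A : StreamingAlgorithm α) (L : Language α) : Prop :=
  A.aut.accepts = L

/-- The space used on input `w`: the maximal encoding length of a state reached by a prefix. -/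
noncomputable def StreamingAlgorithm.space {α : Type*} (A : StreamingAlgorithm α)
    (w : List α) : ℕ∞ :=
  ⨆ (u : List α) (_ : u <+: w), ((A.enc (A.aut.eval u)).length : ℕ∞)

/-! ### Fixed-size sliding windows -/

/-- The active window of length `n`; the initial window is filled with the symbol `a`. -/
def lastWindow {α : Type*} (a : α) (n : ℕ) (w : List α) : List α :=
  List.replicate (n - w.length) a ++ w.drop (w.length - n)

/-- A fixed-size sliding window algorithm for `L` has one streaming algorithm per window size. -/
def IsFixedSizeAlgorithm {α : Type*} (a : α) (L : Language α)
    (A : ℕ → StreamingAlgorithm α) : Prop :=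
  ∀ n, (A n).IsFor {w : List α | lastWindow a n w ∈ L}

/-- The maximal encoding length of a state of the `n`-th algorithm. -/
noncomputable def fixedSpace {α : Type*} (A : ℕ → StreamingAlgorithm α) (n : ℕ) : ℕ∞ :=
  ⨆ q : (A n).State, (((A n).enc q).length : ℕ∞)

/-- Languages with a fixed-size sliding window algorithm of space complexity at most `s`. -/
def FixedSizeClass {α : Type*} (a : α) (s : ℕ → ℕ) : Set (Language α) :=
  {L | ∃ A : ℕ → StreamingAlgorithm α,
    IsFixedSizeAlgorithm a L A ∧ ∀ n, fixedSpace A n ≤ (s n : ℕ∞)}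

/-! ### Variable-size sliding windows -/

/-- The active window of a stream over the extended alphabet: `some a` is the arrival of the
symbol `a` and `none` is the expiration of the first symbol of the window. -/
def wnd {α : Type*} (u : List (Option α)) : List α :=
  u.foldl (fun w x => match x with
    | some a => w ++ [a]
    | none => w.tail) []

/-- A variable-size sliding window algorithm for `L`. -/
def IsVariableSizeAlgorithm {α : Type*} (L : Language α)
    (A : StreamingAlgorithm (Option α)) : Prop :=
  A.IsFor {u : List (Option α) | wnd u ∈ L}

/-- The maximal space used on streams all of whose windows have length at most `n`. -/
noncomputable def variableSpace {α : Type*} (A : StreamingAlgorithm (Option α)) (n : ℕ) : ℕ∞ :=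
  ⨆ (u : List (Option α)) (_ : ∀ v, v <+: u → (wnd v).length ≤ n), A.space u

/-- Languages with a variable-size sliding window algorithm of space complexity at most `s`. -/
def VariableSizeClass {α : Type*} (s : ℕ → ℕ) : Set (Language α) :=
  {L | ∃ A : StreamingAlgorithm (Option α),
    IsVariableSizeAlgorithm L A ∧ ∀ n, variableSpace A n ≤ (s n : ℕ∞)}

/-- The functions `s : ℕ → ℕ` in `O(log n)`, where `log n` is the rounded binary logarithm. -/
def bigOLog : Set (ℕ → ℕ) :=
  {s | (fun n => (s n : ℝ)) =O[Filter.atTop] (fun n => (Nat.log 2 n : ℝ))}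

/-- The class `F(O(log n))`. -/
def FixedLog {α : Type*} (a : α) : Set (Language α) :=
  ⋃ s ∈ bigOLog, FixedSizeClass a s

/-- The class `V(O(log n))`. -/
def VariableLog {α : Type*} : Set (Language α) :=
  ⋃ s ∈ bigOLog, VariableSizeClass s

/-! ### Well-behaved automata -/

/-- A strongly connected component: an inclusion-maximal set of mutually reachable states. -/
def IsSCC {α σ : Type*} (B : DFA α σ) (C : Set σ) : Prop :=
  Maximal (fun D : Set σ => ∀ p ∈ D, ∀ q ∈ D,
    ∃ u v : List α, B.evalFrom p u = q ∧ B.evalFrom q v = p) C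

/-- A well-behaved component: within it, acceptance depends on the start and the length only. -/
def WellBehavedSCC {α σ : Type*} (B : DFA α σ) (C : Set σ) : Prop :=
  ∀ q ∈ C, ∀ u v : List α, u.length = v.length → B.evalFrom q u ∈ C → B.evalFrom q v ∈ C →
    (B.evalFrom q u ∈ B.accept ↔ B.evalFrom q v ∈ B.accept)

/-- Every component that is reachable from the initial state is well-behaved. -/
def WellBehaved {α σ : Type*} (B : DFA α σ) : Prop :=
  ∀ C : Set σ, IsSCC B C → (∃ w : List α, B.eval w ∈ C) → WellBehavedSCC B C

/-- `L` is recognized by a well-behaved automaton with finitely many states. -/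
def RecognizedByWellBehavedDFA {α : Type*} (L : Language α) : Prop :=
  ∃ (σ : Type) (_ : Finite σ) (B : DFA α σ), WellBehaved B ∧ B.accepts = L

/-! ### Mealy machines -/

/-- A Mealy machine with input alphabet `α`, output alphabet `β` and state set `σ`. -/
structure MealyMachine (α β σ : Type*) where
  start : σ
  step : σ → α → σ × β

/-- The length-preserving transduction computed from the state `q`, reading left to right. -/
def MealyMachine.transduce {α β σ : Type*} (M : MealyMachine α β σ) : σ → List α → List β
  | _, [] => []
  | q, a :: u => (M.step q a).2 :: M.transduce (M.step q a).1 u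

/-- The transduction computed by the machine when it works from right to left. -/
def MealyMachine.leftTransduction {α β σ : Type*} (M : MealyMachine α β σ) (x : List α) :
    List β :=
  (M.transduce M.start x.reverse).reverse

/-- `K` is reducible to `L` by a finite-state Mealy machine working from right to left. -/
def LeftReducible {α β : Type*} (K : Language α) (L : Language β) : Prop :=
  ∃ (σ : Type) (_ : Finite σ) (M : MealyMachine α β σ),
    ∀ x : List α, x ∈ K ↔ M.leftTransduction x ∈ L

/-- The growth of `L`: the number of words of length at most `n`. -/
noncomputable def growth {β : Type*} (L : Language β) (n : ℕ) : ℕ :=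
  {x : List β | x ∈ L ∧ x.length ≤ n}.ncard

/-- Polynomial growth (used over finite alphabets only). -/
def PolynomialGrowth {β : Type*} (L : Language β) : Prop :=
  ∃ d : ℕ, (fun n => (growth L n : ℝ)) =O[Filter.atTop] (fun n : ℕ => (n : ℝ) ^ d)

/-! ### Ideals and length languages -/

/-- Left ideals: `Σ* L ⊆ L`. -/
def IsLeftIdeal {α : Type*} (L : Language α) : Prop :=
  (⊤ : Language α) * L ≤ L

/-- For each `n`, the language contains all words of length `n` or none of them. -/
def IsLengthLanguage {α : Type*} (L : Language α) : Prop :=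
  ∀ n : ℕ, (∀ w : List α, w.length = n → w ∈ L) ∨ (∀ w : List α, w.length = n → w ∉ L)

end SlidingWindow

namespace SlidingWindow

open Filter Asymptotics

variable {α : Type*}

/-! ### Asymptotic estimates and counting -/

/-! Condition 3 is the hub. A DFA for the reversal reads the window backwards, newest symbol first,
so a window is a prefix of the reversed stream.

Why 1 and 4 force well-behavedness: a failure gives two loops of one length `m` at a reachable
state, with prefixes `u`, `v` of equal length, one leading to acceptance and one to rejection
(`exists_loops_of_not_wellBehaved`). Sequences of `k` loops code `2 ^ k` bit strings by words of
length linear in `k`. A window algorithm has to tell all of them apart, although logarithmic space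
allows polynomially many states only (`wellBehaved_of_mem_fixedLog`). Likewise a Mealy machine
reducing to `K` must give them different outputs, which after completion lie in `K`, too many for
polynomial growth (`MealyMachine.wellBehaved_thenDFA`).

What well-behavedness gives: after adding a length counter modulo a suitable `d`, membership depends
only on the strongly connected component reached and on the length modulo `d`
(`exists_reachSet_determines`). A component is represented by the set of states reachable from it.
These sets decrease along a run, and there are only polynomially many decreasing words over a finite
order (`ncard_pairwise_ge_le`). This yields the reduction in 4, the compact summaries of windows for
2, and, as lower sets of components define left ideals, the decomposition in 5. For 5 to 3, ideals
and length languages have well-behaved automata for their reversals, and products and complements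
preserve this. For 2 to 1, a fixed window is simulated by insertion followed by expiration. -/

theorem exists_lt_two_pow_of_isBigO_pow {f : ℕ → ℕ} {d : ℕ}
    (hf : (fun n => (f n : ℝ)) =O[atTop] (fun n : ℕ => (n : ℝ) ^ d)) (c : ℕ) {m : ℕ}
    (hm : 0 < m) : ∃ k, f (c + m * k) < 2 ^ k := by
  have hlim : Tendsto (fun k : ℕ => c + m * k) atTop atTop :=
    tendsto_atTop_mono (fun k => (Nat.le_mul_of_pos_left k hm).trans (Nat.le_add_left _ _)) tendsto_id
  have h₁ : (fun k : ℕ => (f (c + m * k) : ℝ)) =O[atTop] (fun k : ℕ => (k : ℝ) ^ d) := by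
    refine (hf.comp_tendsto hlim).trans (IsBigO.pow (IsBigO.of_bound (c + m : ℝ) ?_) d)
    filter_upwards [eventually_ge_atTop 1] with k hk
    have hk' : (1 : ℝ) ≤ k := by exact_mod_cast hk
    have hc : (0 : ℝ) ≤ c := c.cast_nonneg
    simp only [Real.norm_natCast]
    push_cast
    nlinarith
  have h₂ : (fun k : ℕ => (k : ℝ) ^ d) =o[atTop] (fun k : ℕ => (2 : ℝ) ^ k) :=
    isLittleO_pow_const_const_pow_of_one_lt d (by norm_num)
  obtain ⟨k, hk⟩ := ((h₁.trans_isLittleO h₂).bound (by norm_num : (0 : ℝ) < 1 / 2)).exists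
  refine ⟨k, ?_⟩
  have hpos : (0 : ℝ) < 2 ^ k := by positivity
  rw [Real.norm_natCast, Real.norm_of_nonneg hpos.le] at hk
  have : (f (c + m * k) : ℝ) < 2 ^ k := by linarith
  exact_mod_cast this

theorem isBigO_pow_of_le_succ_pow {f : ℕ → ℕ} {d : ℕ} (hf : ∀ n, f n ≤ (n + 1) ^ d) :
    (fun n => (f n : ℝ)) =O[atTop] (fun n : ℕ => (n : ℝ) ^ d) := by
  have h₁ : (fun n => (f n : ℝ)) =O[atTop] (fun n : ℕ => ((n : ℝ) + 1) ^ d) := by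
    refine IsBigO.of_bound 1 (Eventually.of_forall fun n => ?_)
    rw [one_mul, Real.norm_natCast, Real.norm_of_nonneg (by positivity)]
    exact_mod_cast hf n
  refine h₁.trans (IsBigO.pow (IsBigO.of_bound 2 ?_) d)
  filter_upwards [eventually_ge_atTop 1] with n hn
  have hn' : (1 : ℝ) ≤ n := by exact_mod_cast hn
  rw [Real.norm_natCast, Real.norm_of_nonneg (by positivity)]
  linarith

theorem isBigO_four_pow_of_mem_bigOLog {s : ℕ → ℕ} (hs : s ∈ bigOLog) :
    ∃ d : ℕ, (fun n => ((4 ^ s n : ℕ) : ℝ)) =O[atTop] (fun n : ℕ => (n : ℝ) ^ d) := by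
  obtain ⟨C, hC⟩ := IsBigO.bound hs
  refine ⟨2 * ⌈C⌉₊, IsBigO.of_bound 1 ?_⟩
  filter_upwards [hC, eventually_ge_atTop 1] with n hn hn1
  rw [Real.norm_natCast, Real.norm_natCast] at hn
  have h : s n ≤ ⌈C⌉₊ * Nat.log 2 n := by
    have : (s n : ℝ) ≤ ⌈C⌉₊ * Nat.log 2 n :=
      hn.trans (mul_le_mul_of_nonneg_right (Nat.le_ceil C) (Nat.cast_nonneg _))
    exact_mod_cast this
  rw [one_mul, Real.norm_natCast, Real.norm_of_nonneg (by positivity)]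
  have : 4 ^ s n ≤ n ^ (2 * ⌈C⌉₊) := calc
    4 ^ s n ≤ 4 ^ (⌈C⌉₊ * Nat.log 2 n) := Nat.pow_le_pow_right (by norm_num) h
    _ = (2 ^ Nat.log 2 n) ^ (2 * ⌈C⌉₊) := by
      rw [show (4 : ℕ) = 2 ^ 2 by norm_num, ← pow_mul, ← pow_mul]
      congr 1
      ring
    _ ≤ n ^ (2 * ⌈C⌉₊) := Nat.pow_le_pow_left (Nat.pow_log_le_self 2 (by omega)) _
  exact_mod_cast this

theorem mul_log_succ_mem_bigOLog (c : ℕ) : (fun n => (Nat.log 2 n + 1) * c) ∈ bigOLog := by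
  refine IsBigO.of_bound (2 * c : ℝ) ?_
  filter_upwards [eventually_ge_atTop 2] with n hn
  have h : 1 ≤ Nat.log 2 n := Nat.log_pos (by norm_num) hn
  rw [Real.norm_natCast, Real.norm_natCast]
  have : (Nat.log 2 n + 1) * c ≤ 2 * c * Nat.log 2 n := by nlinarith
  exact_mod_cast this

/-- The shift pays for the simulation of a fixed window of length `n`, whose content has length `n +
1` between an insertion and the next expiration. -/
theorem comp_succ_mem_bigOLog {s : ℕ → ℕ} (hs : s ∈ bigOLog) :
    (fun n => s (n + 1)) ∈ bigOLog := by
  refine (IsBigO.comp_tendsto hs (tendsto_add_atTop_nat 1)).trans (IsBigO.of_bound 2 ?_)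
  filter_upwards [eventually_ge_atTop 2] with n hn
  have h₁ : 1 ≤ Nat.log 2 n := Nat.log_pos (by norm_num) hn
  have h₂ : Nat.log 2 (n + 1) ≤ Nat.log 2 n + 1 := by
    rw [← Nat.log_mul_base (by norm_num) (by omega)]
    exact Nat.log_mono_right (by omega)
  simp only [Function.comp_apply, Real.norm_natCast]
  exact_mod_cast (by omega : Nat.log 2 (n + 1) ≤ 2 * Nat.log 2 n)

/-- At most `4 ^ N` objects can be encoded by bit strings of length at most `N`. -/
theorem natCard_le_four_pow {X : Type*} {enc : X → List Bool} (hinj : Function.Injective enc)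
    {N : ℕ} (hN : ∀ x, (enc x).length ≤ N) : Nat.card X ≤ 4 ^ N := by
  -- Reading the bit string at `N` positions gives values in `Option Bool`, hence at most `3 ^ N ≤ 4
  -- ^ N` possibilities.
  have h : Function.Injective fun (x : X) (i : Fin N) => (enc x)[(i : ℕ)]? := by
    intro x y hxy
    refine hinj (List.ext_getElem? fun i => ?_)
    by_cases hi : i < N
    · exact congrFun hxy ⟨i, hi⟩
    · rw [List.getElem?_eq_none ((hN x).trans (not_lt.mp hi)),
        List.getElem?_eq_none ((hN y).trans (not_lt.mp hi))]
  refine (Nat.card_le_card_of_injective _ h).trans ?_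
  rw [Nat.card_eq_fintype_card]
  simpa using Nat.pow_le_pow_left (by norm_num : 3 ≤ 4) N

theorem natBits_injective : Function.Injective Nat.bits := fun m n h => by
  rw [← Nat.digits_inj_iff (b := 2), Nat.digits_two_eq_bits, Nat.digits_two_eq_bits, h]

/-- Write in binary the pair of the size `n` of `x` and an index of `x` among the elements of that
size. The index is below `(n + 1) ^ k` and pairing at most squares, whence the exponent `2 * (k +
1)`. -/
theorem exists_logarithmic_encoding {X : Type*} (size : X → ℕ) (k : ℕ)
    (hfin : ∀ n, {x | size x = n}.Finite) (hcard : ∀ n, {x | size x = n}.ncard ≤ (n + 1) ^ k) :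
    ∃ enc : X → List Bool, Function.Injective enc ∧
      ∀ x, (enc x).length ≤ (Nat.log 2 (size x) + 1) * (2 * (k + 1)) := by
  have hidx (n : ℕ) : ∃ g : X → ℕ, {x | size x = n} ⊆ g ⁻¹' Set.Iio ((n + 1) ^ k) ∧
      Set.InjOn g {x | size x = n} := by
    refine (hfin n).exists_injOn_of_encard_le ?_
    rw [(hfin n).encard_eq_coe_toFinset_card, ← Set.ncard_eq_toFinset_card _ (hfin n),
      (Set.finite_Iio _).encard_eq_coe_toFinset_card, ← Set.ncard_eq_toFinset_card _]
    simpa using (by exact_mod_cast hcard n)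
  choose g hg hinj using hidx
  refine ⟨fun x => Nat.bits (Nat.pair (size x) (g (size x) x)), fun x y hxy => ?_, fun x => ?_⟩
  · have h := Nat.pair_eq_pair.mp (natBits_injective hxy)
    refine hinj (size x) rfl h.1.symm ?_
    rw [h.2, h.1]
  · rw [Nat.size_eq_bits_len, Nat.size_le]
    set n := size x
    have h₁ : g n x < (n + 1) ^ k := hg n rfl
    have h₂ : max n (g n x) + 1 ≤ (n + 1) ^ (k + 1) := by
      have h₃ : (n + 1) ^ k ≤ (n + 1) ^ (k + 1) := Nat.pow_le_pow_right (by omega) (by omega)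
      have h₄ : n + 1 ≤ (n + 1) ^ (k + 1) := Nat.le_self_pow (by omega) _
      omega
    calc Nat.pair n (g n x) < (max n (g n x) + 1) ^ 2 := Nat.pair_lt_max_add_one_sq _ _
      _ ≤ ((n + 1) ^ (k + 1)) ^ 2 := Nat.pow_le_pow_left h₂ 2
      _ ≤ ((2 ^ (Nat.log 2 n + 1)) ^ (k + 1)) ^ 2 := by
        gcongr
        exact Nat.lt_pow_succ_log_self (by norm_num) n
      _ = 2 ^ ((Nat.log 2 n + 1) * (2 * (k + 1))) := by
        rw [← pow_mul, ← pow_mul]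
        congr 1
        ring

/-- Equal multiplicities make the words permutations of each other, and by antisymmetry a multiset
has at most one decreasing arrangement. -/
theorem injOn_count_pairwise_ge {T : Type*} [PartialOrder T] [DecidableEq T] :
    Set.InjOn (fun (y : List T) (t : T) => y.count t) {y | y.Pairwise (· ≥ ·)} := by
  intro y hy z hz hyz
  exact (List.perm_iff_count.mpr (congrFun hyz)).eq_of_pairwise' hy hz

/-- There are only polynomially many decreasing words over a finite partial order. -/
theorem ncard_pairwise_ge_le {T : Type*} [PartialOrder T] [Finite T] (n : ℕ) :
    {y : List T | y.Pairwise (· ≥ ·) ∧ y.length ≤ n}.ncard ≤ (n + 1) ^ Nat.card T := by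
  classical
  have := Fintype.ofFinite T
  rw [← Nat.card_coe_set_eq]
  let φ : {y : List T | y.Pairwise (· ≥ ·) ∧ y.length ≤ n} → T → Fin (n + 1) :=
    fun y t => ⟨y.1.count t, Nat.lt_succ_of_le (List.count_le_length.trans y.2.2)⟩
  have hφ : Function.Injective φ := fun y z hyz => Subtype.ext <|
    injOn_count_pairwise_ge y.2.1 z.2.1 <| funext fun t => congrArg Fin.val (congrFun hyz t)
  refine (Nat.card_le_card_of_injective φ hφ).trans ?_
  simp [Nat.card_eq_fintype_card]

theorem flatMap_injective_of_length_eq {ι β : Type*} {f : ι → List β} {m : ℕ} (hm : 0 < m)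
    (hlen : ∀ i, (f i).length = m) (hf : Function.Injective f) :
    Function.Injective fun l : List ι => l.flatMap f := by
  intro l
  induction l with
  | nil =>
    rintro (_ | ⟨j, l'⟩) h
    · rfl
    · have := congrArg List.length h
      simp [hlen] at this
      omega
  | cons i l ih =>
    rintro (_ | ⟨j, l'⟩) h
    · have := congrArg List.length h
      simp [hlen] at this
      omega
    · simp only [List.flatMap_cons] at h
      obtain ⟨h₁, h₂⟩ := List.append_inj h (by rw [hlen, hlen])
      rw [hf h₁, ih h₂]

/-! ### Well-behaved automata -/

theorem eval_append {σ : Type*} (B : DFA α σ) (x y : List α) :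
    B.eval (x ++ y) = B.evalFrom (B.eval x) y :=
  B.evalFrom_of_append _ _ _

theorem eval_append_congr {σ : Type*} {B : DFA α σ} {x y : List α} (h : B.eval x = B.eval y)
    (z : List α) : B.eval (x ++ z) = B.eval (y ++ z) := by
  rw [eval_append, eval_append, h]

theorem isSCC_mutuallyReachable {σ : Type*} (B : DFA α σ) (q : σ) :
    IsSCC B {p | ∃ u v : List α, B.evalFrom q u = p ∧ B.evalFrom p v = q} := by
  refine ⟨?_, fun D hD hCD p hp => ?_⟩
  · rintro p ⟨u, v, hu, hv⟩ p' ⟨u', v', hu', hv'⟩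
    exact ⟨v ++ u', v' ++ u, by rw [B.evalFrom_of_append, hv, hu'],
      by rw [B.evalFrom_of_append, hv', hu]⟩
  · exact hD q (hCD ⟨[], [], rfl, rfl⟩) p hp

/-- Well-behavedness in terms of words: two words of the same length that can both be extended
to loops at a reachable state lead to the same verdict. -/
theorem wellBehaved_iff {σ : Type*} {B : DFA α σ} :
    WellBehaved B ↔ ∀ w u v u' v' : List α, u.length = v.length →
      B.eval (w ++ u ++ u') = B.eval w → B.eval (w ++ v ++ v') = B.eval w →
      (w ++ u ∈ B.accepts ↔ w ++ v ∈ B.accepts) := by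
  constructor
  · intro h w u v u' v' hlen hu hv
    rw [DFA.mem_accepts, DFA.mem_accepts, eval_append, eval_append]
    rw [eval_append, eval_append] at hu hv
    exact h _ (isSCC_mutuallyReachable B (B.eval w)) ⟨w, [], [], rfl, rfl⟩ _ ⟨[], [], rfl, rfl⟩
      u v hlen ⟨u, u', rfl, hu⟩ ⟨v, v', rfl, hv⟩
  · rintro h C hC ⟨w, hw⟩ q hq u v hlen hu hv
    obtain ⟨x, -, hx, -⟩ := hC.prop _ hw _ hq
    obtain ⟨u', -, hu', -⟩ := hC.prop _ hu _ hq
    obtain ⟨v', -, hv', -⟩ := hC.prop _ hv _ hq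
    rw [← eval_append] at hx
    subst hx
    rw [← eval_append] at hu' hv'
    have := h (w ++ x) u v u' v' hlen (by rw [eval_append, hu']) (by rw [eval_append, hv'])
    rwa [DFA.mem_accepts, DFA.mem_accepts, eval_append, eval_append (x := w ++ x)] at this

/-- A failure of well-behavedness yields two loops of the same positive length at a reachable
state whose prefixes of some common length are not both accepted and not both rejected. -/
theorem exists_loops_of_not_wellBehaved {σ : Type*} {B : DFA α σ} (h : ¬ WellBehaved B) :
    ∃ (w u v u' v' : List α), u.length = v.length ∧ (u ++ u').length = (v ++ v').length ∧
      0 < (u ++ u').length ∧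
      B.evalFrom (B.eval w) (u ++ u') = B.eval w ∧ B.evalFrom (B.eval w) (v ++ v') = B.eval w ∧
      w ++ u ∈ B.accepts ∧ w ++ v ∉ B.accepts := by
  rw [wellBehaved_iff] at h
  push Not at h
  obtain ⟨w, u, v, u', v', hlen, hu, hv, hne⟩ := h
  rw [List.append_assoc, eval_append] at hu hv
  have key : ∀ u v u' v' : List α, u.length = v.length →
      B.evalFrom (B.eval w) (u ++ u') = B.eval w → B.evalFrom (B.eval w) (v ++ v') = B.eval w →
      w ++ u ∈ B.accepts → w ++ v ∉ B.accepts → ∃ (w u v u' v' : List α),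
      u.length = v.length ∧ (u ++ u').length = (v ++ v').length ∧ 0 < (u ++ u').length ∧
      B.evalFrom (B.eval w) (u ++ u') = B.eval w ∧ B.evalFrom (B.eval w) (v ++ v') = B.eval w ∧
      w ++ u ∈ B.accepts ∧ w ++ v ∉ B.accepts := by
    intro u v u' v' hlen hu hv hu₁ hv₁
    -- Following each loop by the other one equalizes their lengths and keeps the prefixes `u` and
    -- `v`.
    refine ⟨w, u, v, u' ++ (v ++ v'), v' ++ (u ++ u'), hlen, by simp; omega, ?_, ?_, ?_, hu₁, hv₁⟩
    · rw [List.length_append]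
      refine Nat.add_pos_left (List.length_pos_of_ne_nil ?_) _
      rintro rfl
      rw [List.eq_nil_of_length_eq_zero (l := v) hlen.symm] at hv₁
      exact hv₁ hu₁
    · rw [← List.append_assoc, B.evalFrom_of_append, hu, hv]
    · rw [← List.append_assoc, B.evalFrom_of_append, hv, hu]
  rcases hne with ⟨h₁, h₂⟩ | ⟨h₁, h₂⟩
  · exact key u v u' v' hlen hu hv h₁ h₂
  · exact key v u v' u' hlen.symm hv hu h₂ h₁

theorem evalFrom_flatMap_of_loops {σ ι : Type*} {B : DFA α σ} {q : σ} {X : ι → List α}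
    (hX : ∀ i, B.evalFrom q (X i) = q) (l : List ι) : B.evalFrom q (l.flatMap X) = q := by
  induction l with
  | nil => rfl
  | cons i l ih => rw [List.flatMap_cons, B.evalFrom_of_append, hX, ih]

theorem length_flatMap_of_length_eq {ι β : Type*} {X : ι → List β} {m : ℕ}
    (hX : ∀ i, (X i).length = m) (l : List ι) : (l.flatMap X).length = m * l.length := by
  induction l with
  | nil => simp
  | cons i l ih =>
    rw [List.flatMap_cons, List.length_append, hX, ih, List.length_cons]
    ring

/-! ### Boolean combinations of left ideals and length languages -/

theorem eval_union {σ₁ σ₂ : Type} (B₁ : DFA α σ₁) (B₂ : DFA α σ₂) (x : List α) :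
    (B₁.union B₂).eval x = (B₁.eval x, B₂.eval x) := by
  induction x using List.reverseRecOn with
  | nil => rfl
  | append_singleton x b ih =>
    rw [DFA.eval_append_singleton, ih, DFA.eval_append_singleton, DFA.eval_append_singleton]
    rfl

theorem RecognizedByWellBehavedDFA.sup {K₁ K₂ : Language α}
    (h₁ : RecognizedByWellBehavedDFA K₁) (h₂ : RecognizedByWellBehavedDFA K₂) :
    RecognizedByWellBehavedDFA (K₁ ⊔ K₂) := by
  obtain ⟨σ₁, _, B₁, hB₁, rfl⟩ := h₁
  obtain ⟨σ₂, _, B₂, hB₂, rfl⟩ := h₂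
  refine ⟨σ₁ × σ₂, inferInstance, B₁.union B₂, ?_, ?_⟩
  · rw [wellBehaved_iff] at hB₁ hB₂ ⊢
    intro w u v u' v' hlen hu hv
    simp only [eval_union, Prod.mk.injEq] at hu hv
    rw [DFA.accepts_union]
    exact or_congr (hB₁ w u v u' v' hlen hu.1 hv.1) (hB₂ w u v u' v' hlen hu.2 hv.2)
  · rw [DFA.accepts_union]
    rfl

theorem RecognizedByWellBehavedDFA.compl {K : Language α} (h : RecognizedByWellBehavedDFA K) :
    RecognizedByWellBehavedDFA Kᶜ := by
  obtain ⟨σ, _, B, hB, rfl⟩ := h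
  refine ⟨σ, inferInstance, Bᶜ, ?_, B.accepts_compl⟩
  rw [wellBehaved_iff] at hB ⊢
  intro w u v u' v' hlen hu hv
  rw [DFA.accepts_compl]
  exact not_congr (hB w u v u' v' hlen hu hv)

theorem recognizedByWellBehavedDFA_bot : RecognizedByWellBehavedDFA (⊥ : Language α) :=
  ⟨Unit, inferInstance, ⟨fun _ _ => (), (), ∅⟩, fun _ _ _ _ _ _ _ _ _ _ => Iff.rfl, rfl⟩

theorem IsLeftIdeal.append_mem {K : Language α} (h : IsLeftIdeal K) {x : List α} (hx : x ∈ K)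
    (y : List α) : y ++ x ∈ K :=
  h (Language.append_mem_mul (show y ∈ (⊤ : Language α) from trivial) hx)

theorem isLeftIdeal_of_append_mem {K : Language α} (h : ∀ x ∈ K, ∀ y : List α, y ++ x ∈ K) :
    IsLeftIdeal K := by
  rintro _ ⟨y, -, x, hx, rfl⟩
  exact h x hx y

/-- The reversal is closed under extension to the right. If `w ++ u` is accepted and `u'` leads back
to the state of `w`, then reading `v` afterwards still accepts, so the verdict is constant on each
reachable component. -/
theorem IsLeftIdeal.recognizedByWellBehavedDFA_reverse {K : Language α} (hK : IsLeftIdeal K)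
    (hreg : K.IsRegular) : RecognizedByWellBehavedDFA K.reverse := by
  obtain ⟨σ, _, B, hB⟩ := hreg.reverse
  refine ⟨σ, inferInstance, B, ?_, hB⟩
  have key : ∀ w u v u' : List α, B.eval (w ++ u ++ u') = B.eval w → w ++ u ∈ B.accepts →
      w ++ v ∈ B.accepts := by
    intro w u v u' hu h
    have h' : w ++ u ++ (u' ++ v) ∈ B.accepts := by
      rw [hB, Language.mem_reverse] at h ⊢
      rw [List.reverse_append]
      exact hK.append_mem h _
    rw [DFA.mem_accepts] at h' ⊢
    rwa [← List.append_assoc, eval_append_congr hu] at h'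
  rw [wellBehaved_iff]
  intro w u v u' v' _ hu hv
  exact ⟨key w u v u' hu, key w v u v' hv⟩

theorem IsLengthLanguage.mem_iff {K : Language α} (hK : IsLengthLanguage K) {x y : List α}
    (h : x.length = y.length) : x ∈ K ↔ y ∈ K := by
  rcases hK y.length with h' | h'
  · exact iff_of_true (h' x h) (h' y rfl)
  · exact iff_of_false (h' x h) (h' y rfl)

theorem IsLengthLanguage.recognizedByWellBehavedDFA_reverse {K : Language α}
    (hK : IsLengthLanguage K) (hreg : K.IsRegular) : RecognizedByWellBehavedDFA K.reverse := by
  obtain ⟨σ, _, B, hB⟩ := hreg.reverse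
  refine ⟨σ, inferInstance, B, ?_, hB⟩
  rw [wellBehaved_iff, hB]
  intro w u v u' v' hlen _ _
  exact hK.mem_iff (by simp [hlen])

theorem recognizedByWellBehavedDFA_reverse_of_mem_closure {L : Language α}
    (h : L ∈ BooleanSubalgebra.closure
      {K : Language α | K.IsRegular ∧ (IsLeftIdeal K ∨ IsLengthLanguage K)}) :
    RecognizedByWellBehavedDFA L.reverse := by
  induction h using BooleanSubalgebra.closure_bot_sup_induction with
  | mem K hK =>
    rcases hK with ⟨hreg, hK | hK⟩
    · exact hK.recognizedByWellBehavedDFA_reverse hreg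
    · exact hK.recognizedByWellBehavedDFA_reverse hreg
  | bot => exact recognizedByWellBehavedDFA_bot
  | sup K₁ _ K₂ _ h₁ h₂ => exact h₁.sup h₂
  | compl K _ h => exact h.compl

/-! ### Lower bound for fixed-size windows -/

theorem lastWindow_reverse_of_length_le (a : α) {n : ℕ} {x : List α} (h : n ≤ x.length) :
    lastWindow a n x.reverse = (x.take n).reverse := by
  rw [lastWindow, List.length_reverse, Nat.sub_eq_zero_of_le h, List.replicate_zero,
    List.nil_append, List.reverse_take]

theorem eval_ne_of_mem_of_notMem {A : StreamingAlgorithm α} {K : Language α} (hA : A.IsFor K)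
    {x y z : List α} (hx : x ++ z ∈ K) (hy : y ++ z ∉ K) : A.aut.eval x ≠ A.aut.eval y := by
  intro h
  rw [← hA, DFA.mem_accepts] at hx hy
  exact hy (eval_append_congr h z ▸ hx)

theorem wellBehaved_of_mem_fixedLog {σ : Type*} {a : α} {L : Language α} {B : DFA α σ}
    (hB : B.accepts = L.reverse) (hL : L ∈ FixedLog a) : WellBehaved B := by
  simp only [FixedLog, Set.mem_iUnion] at hL
  obtain ⟨s, hs, A, hA, hspace⟩ := hL
  by_contra hwb
  obtain ⟨w, u, v, u', v', huv, hlen, hpos, hu, hv, hacc, hrej⟩ :=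
    exists_loops_of_not_wellBehaved hwb
  set m := (u ++ u').length with hm
  let X : Bool → List α := fun b => if b then u ++ u' else v ++ v'
  have hXlen (b : Bool) : (X b).length = m := by
    cases b
    exacts [hlen.symm, rfl]
  have hXloop (b : Bool) : B.evalFrom (B.eval w) (X b) = B.eval w := by cases b <;> simp [X, hu, hv]
  -- The bit `b` is probed by inserting `j = k - p.length` further loops and then `w`. Read
  -- backwards, the window then ends inside the block of `b`, exactly after its prefix `u` or `v`.
  have hwin : ∀ (k : ℕ) (p r : List Bool) (j : ℕ) (b : Bool), p.length + 1 + r.length = k →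
      j + p.length = k → lastWindow a (w.length + u.length + m * k)
        (((p ++ b :: r).flatMap X).reverse ++
          ((List.replicate j true).flatMap X).reverse ++ w.reverse) =
        (w ++ ((List.replicate j true ++ p).flatMap X ++ if b then u else v)).reverse := by
    intro k p r j b hk hj
    rw [← List.reverse_append, ← List.reverse_append, lastWindow_reverse_of_length_le]
    · congr 1
      rw [show w ++ (List.flatMap X (List.replicate j true) ++ List.flatMap X (p ++ b :: r)) =
        (w ++ ((List.replicate j true ++ p).flatMap X ++ if b then u else v)) ++
          ((if b then u' else v') ++ r.flatMap X) by cases b <;> simp [X]]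
      refine List.take_left' ?_
      have : (if b then u else v).length = u.length := by cases b <;> simp [huv]
      rw [List.length_append, List.length_append, this, length_flatMap_of_length_eq hXlen,
        List.length_append, List.length_replicate, hj]
      ring
    -- Since `j ≥ 1`, the stream is at least as long as the window, so no padding symbol `a` occurs
    -- in it.
    · have hm' : u.length ≤ m := by simp [hm]
      have hj1 : 1 ≤ j := by omega
      simp only [List.length_append, length_flatMap_of_length_eq hXlen, List.length_replicate,
        List.length_cons]
      have h₁ : m * (p.length + (r.length + 1)) = m * k := by rw [← hk]; ring
      have h₂ : m ≤ m * j := Nat.le_mul_of_pos_right m hj1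
      omega
  have hmem (k : ℕ) (p r : List Bool) (j : ℕ) (b : Bool) (hk : p.length + 1 + r.length = k)
      (hj : j + p.length = k) : lastWindow a (w.length + u.length + m * k)
        (((p ++ b :: r).flatMap X).reverse ++
          ((List.replicate j true).flatMap X).reverse ++ w.reverse) ∈ L ↔ b = true := by
    rw [hwin k p r j b hk hj, ← Language.mem_reverse, ← hB, DFA.mem_accepts, eval_append,
      B.evalFrom_of_append, evalFrom_flatMap_of_loops hXloop, ← eval_append, ← DFA.mem_accepts]
    cases b <;> simp [hacc, hrej]
  -- Two bit strings that differ at `i` are separated by the continuation that probes position `i`.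
  have hinj (k : ℕ) : Function.Injective fun β : Fin k → Bool =>
      (A (w.length + u.length + m * k)).aut.eval ((List.ofFn β).flatMap X).reverse := by
    have key (β γ : Fin k → Bool) (i : Fin k) (hβ : β i = true) (hγ : γ i = false) :
        (A (w.length + u.length + m * k)).aut.eval ((List.ofFn β).flatMap X).reverse ≠
        (A (w.length + u.length + m * k)).aut.eval ((List.ofFn γ).flatMap X).reverse := by
      have hsplit (δ : Fin k → Bool) : List.ofFn δ =
          (List.ofFn δ).take i ++ δ i :: (List.ofFn δ).drop (i + 1) := by
        conv_lhs => rw [← List.take_append_drop i (List.ofFn δ)]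
        rw [List.drop_eq_getElem_cons (by simp)]
        simp
      refine eval_ne_of_mem_of_notMem (hA _)
        (z := ((List.replicate (k - i) true).flatMap X).reverse ++ w.reverse) ?_ ?_
      · rw [hsplit β, ← List.append_assoc]
        exact (hmem k _ _ _ _ (by simp) (by simp)).mpr hβ
      · rw [hsplit γ, ← List.append_assoc]
        intro h
        have := (hmem k _ _ _ _ (by simp) (by simp)).mp h
        simp [hγ] at this
    intro β γ h
    by_contra hne
    obtain ⟨i, hi⟩ := Function.ne_iff.mp hne
    cases hβ : β i <;> cases hγ : γ i
    · exact hi (hβ.trans hγ.symm)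
    · exact key γ β i hγ hβ h.symm
    · exact key β γ i hβ hγ h
    · exact hi (hβ.trans hγ.symm)
  obtain ⟨d, hd⟩ := isBigO_four_pow_of_mem_bigOLog hs
  obtain ⟨k, hk⟩ := exists_lt_two_pow_of_isBigO_pow hd (w.length + u.length) hpos
  refine hk.not_ge ?_
  have := natCard_le_four_pow ((A (w.length + u.length + m * k)).enc_injective.comp (hinj k))
    (N := s (w.length + u.length + m * k)) fun β => by
      have h := (le_iSup (fun q => (((A (w.length + u.length + m * k)).enc q).length : ℕ∞))
        ((A (w.length + u.length + m * k)).aut.eval ((List.ofFn β).flatMap X).reverse)).trans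
          (hspace (w.length + u.length + m * k))
      exact_mod_cast h
  simpa [Nat.card_eq_fintype_card] using this

/-! ### Reductions to languages of polynomial growth -/

section Mealy

variable {β σ τ : Type*}

/-- The automaton whose states are those of the Mealy machine. -/
def MealyMachine.toDFA (M : MealyMachine α β σ) : DFA α σ := ⟨fun q b => (M.step q b).1, M.start, ∅⟩

theorem MealyMachine.transduce_append (M : MealyMachine α β σ) (q : σ) (x y : List α) :
    M.transduce q (x ++ y) = M.transduce q x ++ M.transduce (M.toDFA.evalFrom q x) y := by
  induction x generalizing q with
  | nil => rfl
  | cons b x ih => simp [transduce, ih, toDFA]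

@[simp]
theorem MealyMachine.length_transduce (M : MealyMachine α β σ) (q : σ) (x : List α) :
    (M.transduce q x).length = x.length := by
  induction x generalizing q with
  | nil => rfl
  | cons b x ih => simp [transduce, ih]

/-- The automaton that runs `G` on the output of the Mealy machine `M`. -/
def MealyMachine.thenDFA (M : MealyMachine α β σ) (G : DFA β τ) : DFA α (σ × τ) where
  step p b := ((M.step p.1 b).1, G.step p.2 (M.step p.1 b).2)
  start := (M.start, G.start)
  accept := {p | p.2 ∈ G.accept}

theorem MealyMachine.evalFrom_thenDFA (M : MealyMachine α β σ) (G : DFA β τ) (p : σ × τ)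
    (x : List α) : (M.thenDFA G).evalFrom p x =
      (M.toDFA.evalFrom p.1 x, G.evalFrom p.2 (M.transduce p.1 x)) := by
  induction x generalizing p with
  | nil => rfl
  | cons b x ih =>
    rw [DFA.evalFrom_cons, DFA.evalFrom_cons, ih]
    rfl

theorem MealyMachine.mem_accepts_thenDFA (M : MealyMachine α β σ) (G : DFA β τ) (x : List α) :
    x ∈ (M.thenDFA G).accepts ↔ M.transduce M.start x ∈ G.accepts := by
  rw [DFA.mem_accepts, DFA.eval, evalFrom_thenDFA]
  rfl

theorem MealyMachine.transduce_flatMap_of_loops (M : MealyMachine α β σ) {ι : Type*} {q : σ}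
    {X : ι → List α} (hX : ∀ i, M.toDFA.evalFrom q (X i) = q) (l : List ι) :
    M.transduce q (l.flatMap X) = l.flatMap fun i => M.transduce q (X i) := by
  induction l with
  | nil => rfl
  | cons i l ih => rw [List.flatMap_cons, List.flatMap_cons, M.transduce_append, hX, ih]

theorem MealyMachine.wellBehaved_thenDFA [Finite β] (M : MealyMachine α β σ) (G : DFA β τ)
    {K : Language β} (hG : G.accepts = K.reverse) (hK : PolynomialGrowth K) :
    WellBehaved (M.thenDFA G) := by
  by_contra hwb
  obtain ⟨w, u, v, u', v', huv, hlen, hpos, hu, hv, hacc, hrej⟩ :=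
    exists_loops_of_not_wellBehaved hwb
  set m := (u ++ u').length with hm
  set q := M.toDFA.eval w with hq
  have hq' : ((M.thenDFA G).eval w).1 = q := by rw [DFA.eval, M.evalFrom_thenDFA]; rfl
  rw [M.mem_accepts_thenDFA, M.transduce_append] at hacc hrej
  -- Equal outputs on the two loops would agree on the prefixes `u` and `v`, and `G` would give both
  -- the same verdict.
  have hne : M.transduce q (u ++ u') ≠ M.transduce q (v ++ v') := by
    intro h
    rw [M.transduce_append, M.transduce_append] at h
    have := (List.append_inj h (by simp [huv])).1
    rw [hq, DFA.eval] at this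
    rw [← show M.toDFA.start = M.start from rfl, ← this] at hrej
    exact hrej hacc
  let X : Bool → List α := fun b => if b then u ++ u' else v ++ v'
  have hXlen (b : Bool) : (X b).length = m := by
    cases b
    exacts [hlen.symm, rfl]
  have hXloop (b : Bool) :
      (M.thenDFA G).evalFrom ((M.thenDFA G).eval w) (X b) = (M.thenDFA G).eval w := by
    cases b <;> simp [X, hu, hv]
  have hXloop' (b : Bool) : M.toDFA.evalFrom q (X b) = q := by
    have := congrArg Prod.fst (hXloop b)
    rwa [M.evalFrom_thenDFA, hq'] at this
  -- Every sequence of loops returns to the state of `w`, from which `u` leads to acceptance.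
  have hmem (l : List Bool) : M.transduce M.start (w ++ (l.flatMap X ++ u)) ∈ K.reverse := by
    rw [← hG, ← M.mem_accepts_thenDFA, DFA.mem_accepts, eval_append, DFA.evalFrom_of_append,
      evalFrom_flatMap_of_loops hXloop, ← eval_append, ← DFA.mem_accepts, M.mem_accepts_thenDFA,
      M.transduce_append]
    exact hacc
  have hinj : Function.Injective fun l : List Bool =>
      M.transduce M.start (w ++ (l.flatMap X ++ u)) := by
    intro l l' h
    simp only [M.transduce_append, List.append_cancel_left_eq] at h
    change M.transduce q _ ++ M.transduce (M.toDFA.evalFrom q _) u =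
      M.transduce q _ ++ M.transduce (M.toDFA.evalFrom q _) u at h
    rw [evalFrom_flatMap_of_loops hXloop', evalFrom_flatMap_of_loops hXloop',
      List.append_cancel_right_eq, M.transduce_flatMap_of_loops hXloop',
      M.transduce_flatMap_of_loops hXloop'] at h
    refine flatMap_injective_of_length_eq hpos (fun b => by simp [hXlen]) (fun b c hbc => ?_) h
    cases b <;> cases c <;> simp [X, hne, hne.symm] at hbc ⊢
  obtain ⟨d, hd⟩ := hK
  obtain ⟨k, hk⟩ := exists_lt_two_pow_of_isBigO_pow hd (w.length + u.length) hpos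
  refine hk.not_ge ?_
  set N := w.length + u.length + m * k with hN
  have hfin : {x : List β | x ∈ K ∧ x.length ≤ N}.Finite :=
    (List.finite_length_le β N).subset fun x hx => hx.2
  have : Finite {x : List β | x ∈ K ∧ x.length ≤ N} := hfin
  let φ : (Fin k → Bool) → {x : List β | x ∈ K ∧ x.length ≤ N} := fun γ =>
    ⟨(M.transduce M.start (w ++ ((List.ofFn γ).flatMap X ++ u))).reverse, hmem _, by
      simp only [List.length_reverse, M.length_transduce, List.length_append,
        length_flatMap_of_length_eq hXlen, List.length_ofFn]
      omega⟩
  have hφ : Function.Injective φ := fun γ δ h =>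
    List.ofFn_injective (hinj (List.reverse_injective (congrArg Subtype.val h)))
  have := Nat.card_le_card_of_injective φ hφ
  rw [Nat.card_coe_set_eq] at this
  simpa [Nat.card_eq_fintype_card, growth] using this

end Mealy

theorem LeftReducible.recognizedByWellBehavedDFA_reverse {β : Type*} [Finite β] {L : Language α}
    {K : Language β} (h : LeftReducible L K) (hreg : K.IsRegular) (hK : PolynomialGrowth K) :
    RecognizedByWellBehavedDFA L.reverse := by
  obtain ⟨σ, _, M, hM⟩ := h
  obtain ⟨τ, _, G, hG⟩ := hreg.reverse
  refine ⟨σ × τ, inferInstance, M.thenDFA G, M.wellBehaved_thenDFA G hG hK, ?_⟩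
  ext x
  rw [M.mem_accepts_thenDFA, hG, Language.mem_reverse, Language.mem_reverse, hM,
    MealyMachine.leftTransduction, List.reverse_reverse]

/-! ### Reachability classes -/

/-- The set of states that are reachable from `s`. -/
def reachSet {σ : Type*} (M : DFA α σ) (s : σ) : Set σ := Set.range (M.evalFrom s)

theorem reachSet_evalFrom_le {σ : Type*} (M : DFA α σ) (s : σ) (x : List α) :
    reachSet M (M.evalFrom s x) ≤ reachSet M s := by
  rintro _ ⟨y, rfl⟩
  exact ⟨x ++ y, M.evalFrom_of_append _ _ _⟩

theorem mem_reachSet_self {σ : Type*} (M : DFA α σ) (s : σ) : s ∈ reachSet M s := ⟨[], rfl⟩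

/-- The product of `B` with a counter of the input length modulo `d`. -/
def withCounter {σ : Type*} (B : DFA α σ) (d : ℕ) : DFA α (σ × ZMod d) where
  step p b := (B.step p.1 b, p.2 + 1)
  start := (B.start, 0)
  accept := {p | p.1 ∈ B.accept}

theorem evalFrom_withCounter {σ : Type*} (B : DFA α σ) (d : ℕ) (p : σ × ZMod d) (x : List α) :
    (withCounter B d).evalFrom p x = (B.evalFrom p.1 x, p.2 + x.length) := by
  induction x generalizing p with
  | nil => simp
  | cons b x ih =>
    rw [DFA.evalFrom_cons, ih, List.length_cons, Nat.cast_succ, add_comm (x.length : ZMod d),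
      ← add_assoc]
    rfl

/-- Take the product over all states of the length of one chosen nonempty loop, with factor `1`
where there is none. Repeating the chosen loop then realizes every multiple of `d` as a loop length.
-/
theorem exists_common_loop_length {σ : Type*} [Finite σ] (B : DFA α σ) :
    ∃ d : ℕ, 0 < d ∧ ∀ (q : σ) (x : List α), x ≠ [] → B.evalFrom q x = q →
      ∃ z : List α, z.length ∣ d ∧ B.evalFrom q z = q ∧ z ≠ [] := by
  have := Fintype.ofFinite σ
  have h (q : σ) : ∃ r : ℕ, 0 < r ∧ ∀ x : List α, x ≠ [] → B.evalFrom q x = q →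
      ∃ z : List α, z.length ∣ r ∧ B.evalFrom q z = q ∧ z ≠ [] := by
    by_cases hq : ∃ x : List α, x ≠ [] ∧ B.evalFrom q x = q
    · obtain ⟨x, hx, hxq⟩ := hq
      exact ⟨x.length, List.length_pos_of_ne_nil hx, fun _ _ _ => ⟨x, dvd_rfl, hxq, hx⟩⟩
    · exact ⟨1, one_pos, fun x hx hxq => (hq ⟨x, hx, hxq⟩).elim⟩
  choose r hr hloop using h
  refine ⟨∏ q, r q, Finset.prod_pos fun q _ => hr q, fun q x hx hxq => ?_⟩
  obtain ⟨z, hz, hzq⟩ := hloop q x hx hxq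
  exact ⟨z, hz.trans (Finset.dvd_prod_of_mem r (Finset.mem_univ q)), hzq⟩

/-- If `K` is recognized by a well-behaved automaton then, for a suitable automaton, membership
in `K` is determined by the strongly connected component of the state that is reached and by the
length of the input modulo a suitable number. -/
theorem RecognizedByWellBehavedDFA.exists_reachSet_determines {K : Language α}
    (h : RecognizedByWellBehavedDFA K) :
    ∃ (σ : Type) (_ : Finite σ) (M : DFA α σ) (d : ℕ), 0 < d ∧ ∀ x y : List α,
      reachSet M (M.eval x) = reachSet M (M.eval y) → (x.length : ZMod d) = y.length →
      (x ∈ K ↔ y ∈ K) := by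
  obtain ⟨σ, _, B, hB, rfl⟩ := h
  obtain ⟨d, hd, hloop⟩ := exists_common_loop_length B
  have : NeZero d := ⟨hd.ne'⟩
  refine ⟨σ × ZMod d, inferInstance, withCounter B d, d, hd, fun x y hxy hlen => ?_⟩
  obtain ⟨u, hu⟩ := hxy.ge (mem_reachSet_self _ _)
  obtain ⟨v, hv⟩ := hxy.le (mem_reachSet_self _ _)
  rw [← eval_append] at hu hv
  simp only [DFA.eval, evalFrom_withCounter, Prod.mk.injEq] at hu hv
  obtain ⟨huB, hulen⟩ := hu
  have hvB := hv.1
  -- This is what the counter is for: a path between the two components' states must preserve the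
  -- length modulo `d`.
  have hdvd : d ∣ u.length := by
    rw [← ZMod.natCast_eq_zero_iff]
    rw [List.length_append, Nat.cast_add, hlen] at hulen
    simpa using hulen
  change B.eval (x ++ u) = B.eval y at huB
  change B.eval (y ++ v) = B.eval x at hvB
  by_cases hnil : u = []
  · subst hnil
    rw [List.append_nil] at huB
    rw [DFA.mem_accepts, DFA.mem_accepts, huB]
  · have hback : B.eval (x ++ u ++ v) = B.eval x := by rw [eval_append_congr huB, hvB]
    obtain ⟨z, hzd, hz, -⟩ := hloop (B.eval x) (u ++ v) (by simp [hnil])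
      (by rw [← eval_append, ← List.append_assoc, hback])
    obtain ⟨k, hk⟩ := hzd.trans hdvd
    -- The repeated loop `z` has the length of `u` but stays at the state of `x`, while `u` leads to
    -- the state of `y`; well-behavedness compares the two.
    have hzk : B.eval (x ++ (List.replicate k ()).flatMap fun _ => z) = B.eval x := by
      rw [eval_append, evalFrom_flatMap_of_loops fun _ => hz]
    have := wellBehaved_iff.mp hB x u ((List.replicate k ()).flatMap fun _ => z) v []
      (by rw [length_flatMap_of_length_eq fun _ => rfl, List.length_replicate, hk]) hback
      (by rw [List.append_nil, hzk])
    rw [DFA.mem_accepts, DFA.mem_accepts, huB, hzk] at this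
    exact this.symm

/-! ### Decomposition into left ideals and length languages -/

/-- Languages saturated by a right congruence of finite index are regular. -/
theorem isRegular_of_determined {β X : Type*} [Finite X] {K : Language β} (f : List β → X)
    (hstep : ∀ x y b, f x = f y → f (x ++ [b]) = f (y ++ [b]))
    (hK : ∀ x y, f x = f y → (x ∈ K ↔ y ∈ K)) : K.IsRegular := by
  have happ (z x y : List β) (h : f x = f y) : f (x ++ z) = f (y ++ z) := by
    induction z using List.reverseRecOn with
    | nil => simpa using h
    | append_singleton z b ih =>
      rw [← List.append_assoc, ← List.append_assoc]
      exact hstep _ _ _ ih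
  have hfac : Function.FactorsThrough K.leftQuotient f := fun x y h => by
    ext z
    exact hK _ _ (happ z x y h)
  refine .of_finite_range_leftQuotient ?_
  -- Left quotients factor through the finite type `X`; the default value `0` off the range of `f`
  -- is immaterial.
  rw [← hfac.extend_comp (e' := fun _ => (0 : Language β)), Set.range_comp]
  exact Set.toFinite _

/-- Prepending letters to `x` prolongs the run on its reversal and shrinks the reachable set, so a
lower set `U` defines a left ideal `I U`. A single value `t` is cut out by `Set.Iic t` minus
`Set.Iio t`, and `L` is the union of the resulting classes, refined by length modulo `d`, that it
meets. -/
theorem RecognizedByWellBehavedDFA.mem_closure {L : Language α}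
    (h : RecognizedByWellBehavedDFA L.reverse) :
    L ∈ BooleanSubalgebra.closure
      {K : Language α | K.IsRegular ∧ (IsLeftIdeal K ∨ IsLengthLanguage K)} := by
  obtain ⟨σ, _, M, d, hd, hM⟩ := h.exists_reachSet_determines
  have : NeZero d := ⟨hd.ne'⟩
  let I : Set (Set σ) → Language α := fun U => {x | reachSet M (M.eval x.reverse) ∈ U}
  let N : ZMod d → Language α := fun r => {x | (x.length : ZMod d) = r}
  have hI (U : Set (Set σ)) (hU : IsLowerSet U) : I U ∈ BooleanSubalgebra.closure
      {K : Language α | K.IsRegular ∧ (IsLeftIdeal K ∨ IsLengthLanguage K)} := by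
    refine BooleanSubalgebra.subset_closure ⟨?_, .inl (isLeftIdeal_of_append_mem fun x hx y => ?_)⟩
    · refine Language.IsRegular.of_reverse (isRegular_of_determined M.eval (fun x y b h => ?_)
        (fun x y h => ?_))
      · exact eval_append_congr h [b]
      · change reachSet M (M.eval x.reverse.reverse) ∈ U ↔ reachSet M (M.eval y.reverse.reverse) ∈ U
        rw [List.reverse_reverse, List.reverse_reverse, h]
    · change reachSet M (M.eval (y ++ x).reverse) ∈ U
      rw [List.reverse_append, eval_append]
      exact hU (reachSet_evalFrom_le M _ _) hx
  have hN (r : ZMod d) : N r ∈ BooleanSubalgebra.closure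
      {K : Language α | K.IsRegular ∧ (IsLeftIdeal K ∨ IsLengthLanguage K)} := by
    refine BooleanSubalgebra.subset_closure ⟨?_, .inr fun n => ?_⟩
    · refine isRegular_of_determined (fun x => (x.length : ZMod d)) (fun x y b h => ?_)
        (fun x y h => by change (x.length : ZMod d) = r ↔ (y.length : ZMod d) = r; rw [h])
      simpa using h
    · by_cases hn : (n : ZMod d) = r
      · exact .inl fun w hw => by subst hw; exact hn
      · exact .inr fun w hw => by subst hw; exact hn
  have hL : L = ⨆ p : {p : Set σ × ZMod d // ∃ x ∈ L.reverse,
      reachSet M (M.eval x) = p.1 ∧ (x.length : ZMod d) = p.2},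
      ((I (Set.Iic p.1.1) \ I (Set.Iio p.1.1)) ⊓ N p.1.2) := by
    ext x
    constructor
    · intro hx
      refine (le_iSup (fun p : {p : Set σ × ZMod d // ∃ x ∈ L.reverse,
        reachSet M (M.eval x) = p.1 ∧ (x.length : ZMod d) = p.2} =>
        ((I (Set.Iic p.1.1) \ I (Set.Iio p.1.1)) ⊓ N p.1.2))
        ⟨(reachSet M (M.eval x.reverse), x.length), x.reverse,
          Language.reverse_mem_reverse.mpr hx, rfl, by simp⟩ :) ⟨⟨?_, ?_⟩, ?_⟩
      · exact le_refl (reachSet M (M.eval x.reverse))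
      · exact lt_irrefl (reachSet M (M.eval x.reverse))
      · rfl
    · intro hx
      obtain ⟨⟨⟨t, r⟩, y, hy, hyt, hyr⟩, ⟨hle, hnlt⟩, hr⟩ := Set.mem_iUnion.mp hx
      have ht : reachSet M (M.eval x.reverse) = t :=
        (show reachSet M (M.eval x.reverse) ≤ t from hle).eq_of_not_lt hnlt
      have hr' : (x.length : ZMod d) = r := hr
      rw [← Language.reverse_mem_reverse, hM x.reverse y (ht.trans hyt.symm)
        (by rw [List.length_reverse, hr', hyr])]
      exact hy
  rw [hL]
  exact BooleanSubalgebra.iSup_mem fun p => BooleanSubalgebra.inf_mem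
    (BooleanSubalgebra.sdiff_mem (hI _ (isLowerSet_Iic _)) (hI _ (isLowerSet_Iio _))) (hN _)

/-! ### The reduction that outputs reachability classes -/

/-- The Mealy machine that runs `M` and outputs the sets of reachable states. -/
def reachMealy {σ : Type*} (M : DFA α σ) : MealyMachine α (Set σ) σ where
  start := M.start
  step s b := (M.step s b, reachSet M (M.step s b))

/-- The upper bound on all letters is carried along to make the induction work. -/
theorem pairwise_transduce_reachMealy {σ : Type*} (M : DFA α σ) (s : σ) (x : List α) :
    ((reachMealy M).transduce s x).Pairwise (· ≥ ·) ∧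
      ∀ t ∈ (reachMealy M).transduce s x, t ≤ reachSet M s := by
  induction x generalizing s with
  | nil => simp [MealyMachine.transduce]
  | cons b x ih =>
    have hstep : reachSet M (M.step s b) ≤ reachSet M s := reachSet_evalFrom_le M s [b]
    obtain ⟨h₁, h₂⟩ := ih (M.step s b)
    refine ⟨List.pairwise_cons.mpr ⟨h₂, h₁⟩, fun t ht => ?_⟩
    rcases List.mem_cons.mp ht with rfl | ht
    · exact hstep
    · exact (h₂ t ht).trans hstep

theorem getLast?_transduce_reachMealy {σ : Type*} (M : DFA α σ) {x : List α} (hx : x ≠ []) :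
    ((reachMealy M).transduce M.start x).getLast? = some (reachSet M (M.eval x)) := by
  obtain ⟨y, b, rfl⟩ := (List.eq_nil_or_concat' x).resolve_left hx
  rw [MealyMachine.transduce_append, DFA.eval_append_singleton]
  simp [MealyMachine.transduce]
  rfl

/-- The decreasing words whose last letter and length are those of the output of the Mealy machine
`reachMealy M` on a word of `K`. -/
def reachLanguage {σ : Type*} (M : DFA α σ) (d : ℕ) (K : Language α) : Language (Set σ) :=
  {y | y.IsChain (· ≥ ·) ∧ ∃ x ∈ K,
    ((reachMealy M).transduce M.start x).getLast? = y.getLast? ∧ (x.length : ZMod d) = y.length}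

/-- The last letter, whether the word is decreasing so far, and its length modulo `d` can be updated
letter by letter. -/
theorem isRegular_reachLanguage {σ : Type*} [Finite σ] (M : DFA α σ) {d : ℕ} (hd : 0 < d)
    (K : Language α) : (reachLanguage M d K).IsRegular := by
  have : NeZero d := ⟨hd.ne'⟩
  refine isRegular_of_determined (fun y : List (Set σ) =>
    (y.getLast?, y.IsChain (· ≥ ·), (y.length : ZMod d))) (fun x y b h => ?_) (fun x y h => ?_)
  · simp only [Prod.mk.injEq] at h ⊢
    simp [List.isChain_append, h]
  · simp only [Prod.mk.injEq] at h
    change (_ ∧ _) ↔ (_ ∧ _)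
    rw [h.1, h.2.1, h.2.2]

theorem polynomialGrowth_reachLanguage_reverse {σ : Type*} [Finite σ] (M : DFA α σ) (d : ℕ)
    (K : Language α) : PolynomialGrowth (reachLanguage M d K).reverse := by
  refine ⟨Nat.card (Set σ), isBigO_pow_of_le_succ_pow fun n => ?_⟩
  refine le_trans ?_ (ncard_pairwise_ge_le (T := Set σ) n)
  refine Set.ncard_le_ncard_of_injOn List.reverse (fun y hy => ⟨?_, ?_⟩)
    List.reverse_injective.injOn ((List.finite_length_le _ n).subset fun y hy => hy.2)
  · exact List.isChain_iff_pairwise.mp hy.1.1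
  · simpa using hy.2

/-- The last output letter is the reachable set of the final state, so it decides membership
together with the length. The empty word has no last letter and is treated separately. -/
theorem transduce_mem_reachLanguage_iff {σ : Type*} {M : DFA α σ} {d : ℕ} {K : Language α}
    (hM : ∀ x y : List α, reachSet M (M.eval x) = reachSet M (M.eval y) →
      (x.length : ZMod d) = y.length → (x ∈ K ↔ y ∈ K)) (x : List α) :
    (reachMealy M).transduce M.start x ∈ reachLanguage M d K ↔ x ∈ K := by
  constructor
  · rintro ⟨-, y, hy, hlast, hlen⟩
    rw [MealyMachine.length_transduce] at hlen
    refine (hM y x ?_ hlen).mp hy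
    by_cases hx : x = []
    · subst hx
      have := congrArg List.length (List.getLast?_eq_none_iff.mp hlast)
      rw [MealyMachine.length_transduce] at this
      rw [List.eq_nil_of_length_eq_zero this]
    · by_cases hy' : y = []
      · subst hy'
        have := congrArg List.length (List.getLast?_eq_none_iff.mp hlast.symm)
        rw [MealyMachine.length_transduce] at this
        rw [List.eq_nil_of_length_eq_zero this]
      · rw [getLast?_transduce_reachMealy M hx, getLast?_transduce_reachMealy M hy'] at hlast
        exact Option.some_injective _ hlast
  · intro hx
    refine ⟨List.isChain_iff_pairwise.mpr (pairwise_transduce_reachMealy M _ x).1, x, hx, rfl, ?_⟩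
    rw [MealyMachine.length_transduce]

theorem RecognizedByWellBehavedDFA.exists_leftReducible {L : Language α}
    (h : RecognizedByWellBehavedDFA L.reverse) :
    ∃ (Γ : Type) (_ : Finite Γ) (K : Language Γ),
      K.IsRegular ∧ PolynomialGrowth K ∧ LeftReducible L K := by
  obtain ⟨σ, _, M, d, hd, hM⟩ := h.exists_reachSet_determines
  refine ⟨Set σ, inferInstance, (reachLanguage M d L.reverse).reverse,
    (isRegular_reachLanguage M hd _).reverse, polynomialGrowth_reachLanguage_reverse M d _,
    σ, inferInstance, reachMealy M, fun x => ?_⟩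
  rw [MealyMachine.leftTransduction, Language.reverse_mem_reverse, ← Language.reverse_mem_reverse]
  exact (transduce_mem_reachLanguage_iff hM x.reverse).symm

/-! ### Variable-size windows -/

@[simp]
theorem wnd_append_some (u : List (Option α)) (b : α) : wnd (u ++ [some b]) = wnd u ++ [b] := by
  simp [wnd]

@[simp]
theorem wnd_append_none (u : List (Option α)) : wnd (u ++ [none]) = (wnd u).tail := by
  simp [wnd]

/-- A summary of the window that can be updated, that determines membership of the window in `L`
and that takes only polynomially many values yields an algorithm of logarithmic space. -/
theorem mem_variableLog_of_summary [Finite α] {X : Type} {L : Language α} (f : List α → X)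
    (happend : ∀ x y b, f x = f y → f (x ++ [b]) = f (y ++ [b]))
    (htail : ∀ x y, f x = f y → f x.tail = f y.tail)
    (hlen : ∀ x y, f x = f y → x.length = y.length)
    (hL : ∀ x y, f x = f y → (x ∈ L ↔ y ∈ L)) (k : ℕ)
    (hcard : ∀ n, (f '' {x | x.length = n}).ncard ≤ (n + 1) ^ k) :
    L ∈ (VariableLog : Set (Language α)) := by
  -- A state is a value of the summary, and updates act on a chosen representative window; the
  -- congruence hypotheses make the choice harmless.
  choose rep hrep using fun q : Set.range f => q.2
  let toState (x : List α) : Set.range f := ⟨f x, x, rfl⟩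
  have hrep' (x : List α) : f (rep (toState x)) = f x := hrep (toState x)
  have himage (n : ℕ) : Subtype.val '' {q : Set.range f | (rep q).length = n} ⊆
      f '' {x | x.length = n} := by
    rintro _ ⟨q, hq, rfl⟩
    exact ⟨rep q, hq, hrep q⟩
  have hfin (n : ℕ) : (f '' {x | x.length = n}).Finite := (List.finite_length_eq α n).image f
  obtain ⟨enc, henc, hbound⟩ := exists_logarithmic_encoding (fun q => (rep q).length) k
    (fun n => .of_finite_image ((hfin n).subset (himage n)) Subtype.val_injective.injOn)
    (fun n => by
      rw [← Set.ncard_image_of_injective _ Subtype.val_injective]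
      exact (Set.ncard_le_ncard (himage n) (hfin n)).trans (hcard n))
  let A : StreamingAlgorithm (Option α) :=
    { State := Set.range f
      aut :=
        { step := fun q c => match c with
            | some b => toState (rep q ++ [b])
            | none => toState (rep q).tail
          start := toState []
          accept := {q | rep q ∈ L} }
      enc := enc
      enc_injective := henc }
  have heval (u : List (Option α)) : A.aut.eval u = toState (wnd u) := by
    induction u using List.reverseRecOn with
    | nil => rfl
    | append_singleton u c ih =>
      rw [DFA.eval_append_singleton, ih]
      cases c with
      | none =>
        rw [wnd_append_none]
        exact Subtype.ext (htail _ _ (hrep' _))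
      | some b =>
        rw [wnd_append_some]
        exact Subtype.ext (happend _ _ b (hrep' _))
  simp only [VariableLog, Set.mem_iUnion]
  refine ⟨_, mul_log_succ_mem_bigOLog (2 * (k + 1)), A, ?_, fun n => ?_⟩
  · ext u
    rw [DFA.mem_accepts, heval]
    exact hL _ _ (hrep' _)
  · refine iSup₂_le fun u hu => iSup₂_le fun v hv => ?_
    rw [heval]
    have h := hbound (toState (wnd v))
    rw [hlen _ _ (hrep' (wnd v))] at h
    exact_mod_cast h.trans (Nat.mul_le_mul_right _ (Nat.succ_le_succ
      (Nat.log_mono_right (hu v hv))))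

theorem MealyMachine.transduce_dropLast {β σ : Type*} (M : MealyMachine α β σ) (q : σ)
    (x : List α) : M.transduce q x.dropLast = (M.transduce q x).dropLast := by
  induction x using List.reverseRecOn with
  | nil => rfl
  | append_singleton x b _ => simp [M.transduce_append, MealyMachine.transduce]

/-- The summary of a window records, for every state `s`, the output of `reachMealy M` on the
reversed window started in `s`. An arriving symbol is read first, so the new output from `s` needs
the old one from the successor of `s`; this is why all states are kept. An expiration deletes the
last output letter. Each output is a decreasing word, which bounds the number of summaries. -/
theorem RecognizedByWellBehavedDFA.mem_variableLog [Finite α] {L : Language α}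
    (h : RecognizedByWellBehavedDFA L.reverse) : L ∈ (VariableLog : Set (Language α)) := by
  obtain ⟨σ, _, M, d, hd, hM⟩ := h.exists_reachSet_determines
  refine mem_variableLog_of_summary (fun x s => (reachMealy M).transduce s x.reverse)
    (fun x y b h => ?_) (fun x y h => ?_) (fun x y h => ?_) (fun x y h => ?_)
    (Nat.card (Set σ) * Nat.card σ) fun n => ?_
  · funext s
    simpa [MealyMachine.transduce] using congrFun h _
  · funext s
    simp only [← List.dropLast_reverse, MealyMachine.transduce_dropLast]
    rw [congrFun h s]
  · simpa using congrArg List.length (congrFun h M.start)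
  · rw [← Language.reverse_mem_reverse, ← transduce_mem_reachLanguage_iff hM,
      ← Language.reverse_mem_reverse (a := y), ← transduce_mem_reachLanguage_iff hM,
      congrFun h M.start]
  · set D := {y : List (Set σ) | y.Pairwise (· ≥ ·) ∧ y.length ≤ n} with hD
    have : Finite D := (List.finite_length_le _ n).subset fun y hy => hy.2
    set E := (fun (x : List α) (s : σ) => (reachMealy M).transduce s x.reverse) '' {x | x.length = n}
    have hE : ∀ g ∈ E, ∀ s, g s ∈ D := by
      rintro _ ⟨x, hx, rfl⟩ s
      exact ⟨(pairwise_transduce_reachMealy M s _).1, by simpa using hx.le⟩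
    let φ : E → σ → D := fun g s => ⟨g.1 s, hE g.1 g.2 s⟩
    have hφ : Function.Injective φ := fun g g' h => Subtype.ext <| funext fun s =>
      congrArg Subtype.val (congrFun h s)
    calc E.ncard ≤ D.ncard ^ Nat.card σ := by
          rw [← Nat.card_coe_set_eq, ← Nat.card_coe_set_eq, ← Nat.card_fun]
          exact Nat.card_le_card_of_injective φ hφ
      _ ≤ ((n + 1) ^ Nat.card (Set σ)) ^ Nat.card σ :=
          Nat.pow_le_pow_left (ncard_pairwise_ge_le n) _
      _ = (n + 1) ^ (Nat.card (Set σ) * Nat.card σ) := (pow_mul _ _ _).symm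

/-! ### Simulation of fixed-size windows by variable-size windows -/

theorem lastWindow_eq_drop (a : α) (n : ℕ) (w : List α) :
    lastWindow a n w = (List.replicate n a ++ w).drop w.length := by
  rw [List.drop_append, List.drop_replicate, List.length_replicate, lastWindow]

/-- The stream that fills the window with `n` symbols `a` and then slides it along `w`. -/
def slidingStream (a : α) (n : ℕ) (w : List α) : List (Option α) :=
  List.replicate n (some a) ++ w.flatMap fun b => [some b, none]

theorem slidingStream_append_singleton (a : α) (n : ℕ) (w : List α) (b : α) :
    slidingStream a n (w ++ [b]) = slidingStream a n w ++ [some b] ++ [none] := by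
  simp [slidingStream]

theorem wnd_replicate_some (a : α) (n : ℕ) :
    wnd (List.replicate n (some a)) = List.replicate n a := by
  induction n with
  | zero => rfl
  | succ n ih => rw [List.replicate_succ', wnd_append_some, ih, List.replicate_succ']

theorem wnd_slidingStream (a : α) (n : ℕ) (w : List α) :
    wnd (slidingStream a n w) = lastWindow a n w := by
  induction w using List.reverseRecOn with
  | nil => simp [slidingStream, lastWindow, wnd_replicate_some]
  | append_singleton w b ih =>
    rw [slidingStream_append_singleton, wnd_append_none, wnd_append_some, ih, lastWindow_eq_drop,
      lastWindow_eq_drop, List.length_append, List.length_singleton, ← List.drop_drop,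
      List.drop_one, ← List.append_assoc, List.drop_append_of_le_length (l₂ := [b]) (by simp)]

theorem length_lastWindow (a : α) (n : ℕ) (w : List α) : (lastWindow a n w).length = n := by
  simp [lastWindow_eq_drop]

/-- Each new symbol is inserted before the oldest one expires, hence the bound `n + 1`. -/
theorem length_wnd_le_of_prefix_slidingStream (a : α) (n : ℕ) (w : List α) (v : List (Option α))
    (hv : v <+: slidingStream a n w) : (wnd v).length ≤ n + 1 := by
  induction w using List.reverseRecOn with
  | nil =>
    have hv' : v <+: List.replicate n (some a) := by simpa [slidingStream] using hv
    obtain ⟨hle, hv'⟩ := List.prefix_replicate_iff.mp hv'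
    rw [hv', wnd_replicate_some, List.length_replicate]
    omega
  | append_singleton w b ih =>
    rw [slidingStream_append_singleton, List.prefix_concat_iff, List.prefix_concat_iff] at hv
    rcases hv with rfl | rfl | hv
    · rw [wnd_append_none, wnd_append_some, wnd_slidingStream]
      simp [length_lastWindow]
    · rw [wnd_append_some, wnd_slidingStream]
      simp [length_lastWindow]
    · exact ih hv

theorem mem_fixedLog_of_mem_variableLog (a : α) {L : Language α}
    (hL : L ∈ (VariableLog : Set (Language α))) : L ∈ FixedLog a := by
  simp only [VariableLog, FixedLog, Set.mem_iUnion] at hL ⊢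
  obtain ⟨s, hs, A, hA, hspace⟩ := hL
  let st (n : ℕ) (w : List α) : A.State := A.aut.eval (slidingStream a n w)
  have hst (n : ℕ) (w : List α) (b : α) :
      st n (w ++ [b]) = A.aut.evalFrom (st n w) [some b, none] := by
    simp only [st]
    rw [slidingStream_append_singleton, List.append_assoc, eval_append]
    rfl
  -- States are restricted to those reached on sliding streams, as `fixedSpace` ranges over all
  -- states and only these have bounded encodings.
  let F (n : ℕ) : StreamingAlgorithm α :=
    { State := Set.range (st n)
      aut :=
        { step := fun q b => ⟨A.aut.evalFrom q [some b, none], by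
            obtain ⟨_, w, rfl⟩ := q
            exact ⟨w ++ [b], hst n w b⟩⟩
          start := ⟨st n [], [], rfl⟩
          accept := {q | (q : A.State) ∈ A.aut.accept} }
      enc := fun q => A.enc q
      enc_injective := A.enc_injective.comp Subtype.val_injective }
  have heval (n : ℕ) (w : List α) : (F n).aut.eval w = (⟨st n w, w, rfl⟩ : Set.range (st n)) := by
    induction w using List.reverseRecOn with
    | nil => rfl
    | append_singleton w b ih =>
      rw [DFA.eval_append_singleton, ih]
      exact Subtype.ext (hst n w b).symm
  refine ⟨_, comp_succ_mem_bigOLog hs, F, fun n => ?_, fun n => ?_⟩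
  · ext w
    rw [DFA.mem_accepts, heval]
    change slidingStream a n w ∈ A.aut.accepts ↔ lastWindow a n w ∈ L
    rw [hA, ← wnd_slidingStream]
    rfl
  · refine iSup_le ?_
    rintro ⟨_, w, rfl⟩
    refine le_trans ?_ (hspace (n + 1))
    refine le_trans ?_ (le_iSup₂ (f := fun (u : List (Option α))
      (_ : ∀ v, v <+: u → (wnd v).length ≤ n + 1) => A.space u) (slidingStream a n w)
      (length_wnd_le_of_prefix_slidingStream a n w))
    exact le_iSup₂ (f := fun (u : List (Option α)) (_ : u <+: slidingStream a n w) =>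
      ((A.enc (A.aut.eval u)).length : ℕ∞)) (slidingStream a n w) List.prefix_rfl

end SlidingWindow

theorem mainTheorem1 {α : Type*} [Finite α] (a : α) (L : Language α) (hL : L.IsRegular) :
    [ L ∈ SlidingWindow.FixedLog a,
      L ∈ (SlidingWindow.VariableLog : Set (Language α)),
      SlidingWindow.RecognizedByWellBehavedDFA L.reverse,
      ∃ (Γ : Type) (_ : Finite Γ) (K : Language Γ),
        K.IsRegular ∧ SlidingWindow.PolynomialGrowth K ∧ SlidingWindow.LeftReducible L K,
      L ∈ BooleanSubalgebra.closure
        {K : Language α | K.IsRegular ∧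
          (SlidingWindow.IsLeftIdeal K ∨ SlidingWindow.IsLengthLanguage K)} ].TFAE := by
  -- Any DFA for the reversal will do: the space bound forces it to be well-behaved.
  tfae_have 1 → 3 := fun h => by
    obtain ⟨σ, _, B, hB⟩ := hL.reverse
    exact ⟨σ, inferInstance, B, SlidingWindow.wellBehaved_of_mem_fixedLog hB h, hB⟩
  tfae_have 3 → 2 := fun h => h.mem_variableLog
  tfae_have 2 → 1 := SlidingWindow.mem_fixedLog_of_mem_variableLog a
  tfae_have 3 → 4 := fun h => h.exists_leftReducible
  tfae_have 4 → 3 := fun ⟨_, _, _, hreg, hgrowth, hred⟩ =>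
    hred.recognizedByWellBehavedDFA_reverse hreg hgrowth
  tfae_have 3 → 5 := fun h => h.mem_closure
  tfae_have 5 → 3 := SlidingWindow.recognizedByWellBehavedDFA_reverse_of_mem_closure
  tfae_finish
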